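/- **Setting (frame-asynchronous IRSA with NOMA, two types).** Slots are numbered $1,2,\dots$, and $N\ge 1$ is the length of a user's local frame. For $t\in\{1,2\}$, the numbers of type $t$ users arriving in the different slots are independent Poisson variables with mean $g^{(t)}\ge 0$. A type $t$ user arriving in slot $k$ (a class $k$ user) draws its number $d\in\{1,\dots,N\}$ of replicas with probability $L^{(t)}_d$, sends one replica in slot $k$ and the other $d-1$ in a uniformly random $(d-1)$-subset of $\mathcal I_k=\{k+1,\dots,k+N-1\}$; all users act independently. Let $\mathcal L^{(t)}[x]=\sum_d L^{(t)}_d x^d$, $\mathcal L^{(t)}_{\mathrm{lat}}[x]=\sum_d L^{(t)}_d x^{d-1}$ and $\lambda^{(t)}_{\mathrm{lat}}[x]=\mathcal L^{(t)\prime}_{\mathrm{lat}}[x]/\mathcal L^{(t)\prime}_{\mathrm{lat}}[1]$. Slot $i$ has one check node of each type $t$ (the class $i$ type $t$ check node), joined by an edge to every type $t$ user (variable node) transmitting in slot $i$. For $i\ge1$ let $\mathcal K_i=\{1,\dots,i-1\}$ if $i<N$ and $\mathcal K_i=\{i-N+1,\dots,i-1\}$ if $i\ge N$; the class of such a user is $i$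 or lies in $\mathcal K_i$. **Density evolution.** Let $y^{(t)}_{i\to j,\ell}$ be the average erasure probability of a message from the class $i$ type $t$ check node to a class $j$ type $t$ variable node in iteration $\ell$, and $x^{(t)}_{k\to i,\ell}$ that of a message from a class $k$ type $t$ variable node to the class $i$ type $t$ check node. They are determined as follows. * Variable nodes: with $\tilde y^{(t)}_{k,\ell}=\frac1{N-1}\sum_{a\in\mathcal I_k}y^{(t)}_{a\to k,\ell}$, $$x^{(t)}_{k\to k,\ell}=\mathcal L^{(t)}_{\mathrm{lat}}[\tilde y^{(t)}_{k,\ell}],\qquad x^{(t)}_{k\to i,\ell}=y^{(t)}_{k\to k,\ell}\,\lambda^{(t)}_{\mathrm{lat}}[\tilde y^{(t)}_{k,\ell}]\quad(i\ne k).$$ * Check nodes: given the edges of the two check nodes of slot $i$, which are random as prescribed by the protocol, the message arriving along a type $s$ edge from a class $k$ variable node is erased with probability $x^{(s)}_{k\to i,\ell}$, independently over all edges. The outgoing message in iteration $\ell+1$ along a type $t$ edge is not erased if and only if no message arriving along another type $t$ edge of the slot is erased and at most one message arriving along the edges of the other type is erased (that is, the pattern of unresolved packets is type $t$ decodable). Then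 $y^{(t)}_{i\to j,\ell+1}$ is the expected number of edges from the class $i$ type $t$ check node to class $j$ variable nodes with an erased outgoing message, divided by the expected number of edges from that check node to class $j$ variable nodes. * Initially, $y^{(t)}_{i\to j,0}$ is obtained by the same check node rule with all arriving messages erased. For $i\ge 1$ put $\delta_i^{(t)}=\min(i-1,N-1)\,g^{(t)}$, $\kappa_i^{(t)}=\delta_i^{(t)}\big(\mathcal L^{(t)\prime}[1]-1\big)/(N-1)$, and let $\tilde x^{(t)}_{i,\ell}$ be the average of $x^{(t)}_{k\to i,\ell}$ over $k\in\mathcal K_i$ ($\kappa_i^{(t)}=\tilde x^{(t)}_{i,\ell}=0$ if $\mathcal K_i=\emptyset$). For fixed $i,\ell$ define $$f_1(t)=e^{-g^{(t)}x^{(t)}_{i\to i,\ell}},\quad f_2(t)=e^{-\kappa_i^{(t)}\tilde x^{(t)}_{i,\ell}},\quad f_3(t)=x^{(t)}_{i\to i,\ell}\,g^{(t)}e^{-g^{(t)}x^{(t)}_{i\to i,\ell}},\quad f_4(t)=\tilde x^{(t)}_{i,\ell}\,\kappa_i^{(t)}e^{-\kappa_i^{(t)}\tilde x^{(t)}_{i,\ell}}.$$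 **Proposition.** Let $t\in\{1,2\}$, let $\bar t$ be the other type, and let $i\ge1$, $\ell\ge0$. If $g^{(t)}>0$, then $$y^{(t)}_{i\to i,\ell+1}=1-f_1(t)f_2(t)\big(f_1(\bar t)f_2(\bar t)+f_3(\bar t)f_2(\bar t)+f_1(\bar t)f_4(\bar t)\big).$$ If moreover $\mathcal L^{(t)\prime}[1]>1$, then $y^{(t)}_{i\to j,\ell+1}$ has the same value for every $j\in\mathcal K_i$. Furthermore, for each type $s\in\{1,2\}$, $f_1(s)f_2(s)+f_3(s)f_2(s)+f_1(s)f_4(s)$ is the probability that at most one of the messages arriving at the class $i$ type $s$ check node along its edges is erased (iteration $\ell$). -/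

import Mathlib

open scoped NNReal ENNReal unitInterval

noncomputable section

namespace IRSA

/-- The set of type `t` decodable patterns for power-domain NOMA with `T` types (decoding order
`0 → 1 → … → T - 1`): exactly one unresolved packet of type `t`, at most one of each type decoded
earlier, and limited interference from the types decoded later.  For `T = 2` this says that type `t`
has one unresolved packet and the other type has none or one. -/
def decodableSet {T : ℕ} (t : Fin T) : Set (Fin T → ℕ) :=
  {c | c t = 1 ∧ (∀ s, s < t → c s ≤ 1) ∧ (∀ s, t < s → c s ≤ (s : ℕ) - (t : ℕ)) ∧
    ∑ s ∈ Finset.univ.filter (fun s => t < s), c s ≤ T - 1 - (t : ℕ)}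

/-- The law of the union (sum) of independent random multisets with the given laws. -/
def superpose {α : Type} : List (PMF (Multiset α)) → PMF (Multiset α)
  | [] => PMF.pure 0
  | p :: ps => p.bind fun a => (superpose ps).map fun b => a + b

/-- Parameters of frame-asynchronous IRSA with NOMA with two types of users: local frame length
`N`, arrival rates `g t`, and the laws `L t` of the number of replicas of a type `t` user. -/
structure Model where
  N : ℕ
  g : Fin 2 → ℝ≥0
  L : Fin 2 → PMF ℕ
  L_supp : ∀ t, ∀ d ∈ (L t).support, 1 ≤ d ∧ d ≤ N

namespace Model

variable (M : Model)

/-! ### The access protocol -/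

/-- The slots `[k + 1 : k + N - 1]` in which a user that arrives in slot `k` (a class `k` user) may
send its further replicas. -/
def laterSlots (k : ℕ) : Finset ℕ := Finset.Icc (k + 1) (k + M.N - 1)

/-- The classes `k ≠ i` whose users may transmit in slot `i`. -/
def earlierClasses (i : ℕ) : Finset ℕ :=
  if i < M.N then Finset.Icc 1 (i - 1) else Finset.Icc (i - M.N + 1) (i - 1)

theorem card_laterSlots (k : ℕ) : (M.laterSlots k).card = M.N - 1 := by
  simp only [laterSlots, Nat.card_Icc]; omega

/-- The law of the set of slots used by a type `t` user that arrives in slot `k`: it draws its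
number `d` of replicas from `L t`, sends one in slot `k`, and the other `d - 1` in a uniformly
random `(d - 1)`-subset of the later slots of its local frame. -/
def userPattern (t : Fin 2) (k : ℕ) : PMF (Finset ℕ) :=
  (M.L t).bindOnSupport fun d hd =>
    (PMF.uniformOfFinset ((M.laterSlots k).powersetCard (d - 1))
      (Finset.powersetCard_nonempty.2 (by
        rw [card_laterSlots]; have := M.L_supp t d hd; omega))).map (insert k)

/-! ### Degree distributions of the variable nodes -/

/-- The degree polynomial `𝓛(X) = ∑ L_d X ^ d`. -/
def degPoly (t : Fin 2) : Polynomial ℝ :=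
  ∑ d ∈ Finset.Icc 1 M.N, Polynomial.monomial d (M.L t d).toReal

/-- `𝓛'(1)`, the mean number of replicas of a type `t` user. -/
def meanDegree (t : Fin 2) : ℝ := (M.degPoly t).derivative.eval 1

/-- The degree polynomial `∑ L_d X ^ (d - 1)` of a user towards the later slots of its frame. -/
def laterPoly (t : Fin 2) : Polynomial ℝ :=
  ∑ d ∈ Finset.Icc 1 M.N, Polynomial.monomial (d - 1) (M.L t d).toReal

/-- The edge-perspective version of `laterPoly`, as a function. -/
def edgeLater (t : Fin 2) (z : ℝ) : ℝ :=
  (M.laterPoly t).derivative.eval z / (M.laterPoly t).derivative.eval 1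

theorem eval_bounds {p : Polynomial ℝ} (hp : ∀ n, 0 ≤ p.coeff n) {z : ℝ} (hz : z ∈ I) :
    0 ≤ p.eval z ∧ p.eval z ≤ p.eval 1 := by
  rw [Polynomial.eval_eq_sum_range, Polynomial.eval_eq_sum_range]
  constructor
  · exact Finset.sum_nonneg fun n _ => mul_nonneg (hp n) (pow_nonneg hz.1 n)
  · refine Finset.sum_le_sum fun n _ => mul_le_mul_of_nonneg_left ?_ (hp n)
    rw [one_pow]
    exact pow_le_one₀ hz.1 hz.2

theorem laterPoly_coeff_nonneg (t : Fin 2) (n : ℕ) : 0 ≤ (M.laterPoly t).coeff n := by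
  rw [laterPoly, Polynomial.finsetSum_coeff]
  refine Finset.sum_nonneg fun d _ => ?_
  rw [Polynomial.coeff_monomial]
  split_ifs
  · exact ENNReal.toReal_nonneg
  · exact le_rfl

theorem laterPoly_mem (t : Fin 2) {z : ℝ} (hz : z ∈ I) : (M.laterPoly t).eval z ∈ I := by
  obtain ⟨h0, h1⟩ := eval_bounds (M.laterPoly_coeff_nonneg t) hz
  refine ⟨h0, h1.trans ?_⟩
  simp only [laterPoly, Polynomial.eval_finsetSum, Polynomial.eval_monomial, one_pow, mul_one]
  rw [← ENNReal.toReal_sum fun d _ => (M.L t).apply_ne_top d]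
  refine ENNReal.toReal_le_of_le_ofReal zero_le_one ?_
  rw [ENNReal.ofReal_one, ← (M.L t).tsum_coe]
  exact ENNReal.sum_le_tsum _

theorem edgeLater_mem (t : Fin 2) {z : ℝ} (hz : z ∈ I) : M.edgeLater t z ∈ I := by
  have hc : ∀ n, 0 ≤ (M.laterPoly t).derivative.coeff n := fun n => by
    rw [Polynomial.coeff_derivative]
    exact mul_nonneg (M.laterPoly_coeff_nonneg t _) (by positivity)
  obtain ⟨h0, h1⟩ := eval_bounds hc hz
  exact ⟨div_nonneg h0 (h0.trans h1), div_le_one_of_le₀ h1 (h0.trans h1)⟩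

/-! ### Variable-node update

A family `m : Fin 2 → ℕ → ℕ → I` of message erasure probabilities is indexed by the type, the class
of the sending node and the class of the receiving node. -/

/-- The average erasure probability of a message that reaches a class `k` type `t` variable node
from the check nodes in its later slots. -/
def avgFromLater (y : Fin 2 → ℕ → ℕ → I) (t : Fin 2) (k : ℕ) : ℝ :=
  1 / ((M.N : ℝ) - 1) * ∑ a ∈ M.laterSlots k, (y t a k : ℝ)

theorem avgFromLater_mem (y : Fin 2 → ℕ → ℕ → I) (t : Fin 2) (k : ℕ) :
    M.avgFromLater y t k ∈ I := by
  have h0 : 0 ≤ ∑ a ∈ M.laterSlots k, (y t a k : ℝ) :=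
    Finset.sum_nonneg fun a _ => (y t a k).2.1
  have h1 : ∑ a ∈ M.laterSlots k, (y t a k : ℝ) ≤ (M.N : ℝ) - 1 := by
    have hN : 1 ≤ M.N := by
      obtain ⟨d, hd⟩ := (M.L 0).support_nonempty
      have := M.L_supp 0 d hd
      omega
    calc ∑ a ∈ M.laterSlots k, (y t a k : ℝ) ≤ ∑ _a ∈ M.laterSlots k, (1 : ℝ) :=
          Finset.sum_le_sum fun a _ => (y t a k).2.2
      _ = (M.N : ℝ) - 1 := by
          rw [Finset.sum_const, card_laterSlots, nsmul_eq_mul, mul_one, Nat.cast_sub hN,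
            Nat.cast_one]
  rw [avgFromLater, one_div, ← div_eq_inv_mul]
  exact ⟨div_nonneg h0 (h0.trans h1), div_le_one_of_le₀ h1 (h0.trans h1)⟩

/-- Variable-node update: the erasure probability of the message from a class `k` type `t` variable
node to the type `t` check node of slot `i`.  The message is erased iff all the messages arriving
along the other edges are erased.  For `i = k` these are the edges towards the later slots; for a
later slot `i` these are the edge to slot `k` and the remaining edges towards later slots. -/
def varUpdate (y : Fin 2 → ℕ → ℕ → I) (t : Fin 2) (k i : ℕ) : I :=
  if i = k then ⟨(M.laterPoly t).eval (M.avgFromLater y t k),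
    M.laterPoly_mem t (M.avgFromLater_mem y t k)⟩
  else y t k k * ⟨M.edgeLater t (M.avgFromLater y t k),
    M.edgeLater_mem t (M.avgFromLater_mem y t k)⟩

/-! ### Check-node update

An edge of a check node is recorded as `(k, e)`, where `k` is the class of the variable node at its
other end and `e = true` iff the message arriving along the edge is erased. -/

/-- The law of the edges (none or one) that a class `k` type `t` user contributes to slot `i`; its
incoming message is erased with probability `x t k i`. -/
def userEdge (x : Fin 2 → ℕ → ℕ → I) (t : Fin 2) (i k : ℕ) : PMF (Multiset (ℕ × Bool)) :=
  (M.userPattern t k).bind fun A =>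
    if i ∈ A then
      (ProbabilityTheory.bernoulliMeasure true false (x t k i)).toPMF.map fun e => {(k, e)}
    else PMF.pure 0

/-- The law of the edges that all class `k` type `t` users contribute to slot `i`; the number of
these users is Poisson with mean `g t`, and they act independently. -/
def classEdges (x : Fin 2 → ℕ → ℕ → I) (t : Fin 2) (i k : ℕ) : PMF (Multiset (ℕ × Bool)) :=
  (ProbabilityTheory.poissonMeasure (M.g t)).toPMF.bind fun m =>
    superpose (List.replicate m (M.userEdge x t i k))

/-- The law of the edges of the type `t` check node of slot `i`, contributed by the users that
arrived in the slots `1, …, i`. -/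
def checkEdges (x : Fin 2 → ℕ → ℕ → I) (t : Fin 2) (i : ℕ) : PMF (Multiset (ℕ × Bool)) :=
  superpose ((List.range' 1 i).map (M.classEdges x t i))

/-- The joint law of the edges of the two (independent) check nodes of slot `i`. -/
def slotWeight (x : Fin 2 → ℕ → ℕ → I) (i : ℕ) (ω : Fin 2 → Multiset (ℕ × Bool)) : ℝ≥0∞ :=
  ∏ s, M.checkEdges x s i (ω s)

/-- The number of edges with an erased incoming message. -/
def erasedCount (a : Multiset (ℕ × Bool)) : ℕ := a.countP fun e => e.2 = true

/-- The pattern of unresolved packets in a slot, as seen by the outgoing message along the type `t`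
edge `e`: the packet of `e` itself counts as unresolved, and any other packet is unresolved iff its
incoming message is erased. -/
def extrinsicPattern (ω : Fin 2 → Multiset (ℕ × Bool)) (t : Fin 2) (e : ℕ × Bool) : Fin 2 → ℕ :=
  fun s => if s = t then 1 + erasedCount ((ω t).erase e) else erasedCount (ω s)

/-- The number of type `t` edges to class `j` variable nodes. -/
def edgesTo (ω : Fin 2 → Multiset (ℕ × Bool)) (t : Fin 2) (j : ℕ) : ℕ :=
  (ω t).countP fun e => e.1 = j

open Classical in
/-- The number of type `t` edges to class `j` variable nodes whose outgoing message is erased,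
that is, whose extrinsic pattern is not type `t` decodable. -/
def erasedEdgesTo (ω : Fin 2 → Multiset (ℕ × Bool)) (t : Fin 2) (j : ℕ) : ℕ :=
  (ω t).countP fun e => e.1 = j ∧ extrinsicPattern ω t e ∉ decodableSet t

/-- Mean number of edges from the type `t` check node of slot `i` to class `j` variable nodes. -/
def meanEdges (x : Fin 2 → ℕ → ℕ → I) (t : Fin 2) (i j : ℕ) : ℝ≥0∞ :=
  ∑' ω, M.slotWeight x i ω * (edgesTo ω t j : ℝ≥0∞)

/-- Mean number of those edges whose outgoing message is erased. -/
def meanErasedEdges (x : Fin 2 → ℕ → ℕ → I) (t : Fin 2) (i j : ℕ) : ℝ≥0∞ :=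
  ∑' ω, M.slotWeight x i ω * (erasedEdgesTo ω t j : ℝ≥0∞)

theorem meanErasedEdges_le (x : Fin 2 → ℕ → ℕ → I) (t : Fin 2) (i j : ℕ) :
    M.meanErasedEdges x t i j ≤ M.meanEdges x t i j := by
  classical
  refine ENNReal.tsum_le_tsum fun ω => mul_le_mul_right ?_ _
  refine Nat.cast_le.2 ?_
  rw [erasedEdgesTo, edgesTo, Multiset.countP_eq_card_filter, Multiset.countP_eq_card_filter]
  exact Multiset.card_le_card (Multiset.monotone_filter_right _ fun _ h => h.1)

/-- Check-node update: the erasure probability, averaged over all the edges from the class `i` type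
`t` check node to class `j` variable nodes, of the message sent along such an edge. -/
def checkUpdate (x : Fin 2 → ℕ → ℕ → I) (t : Fin 2) (i j : ℕ) : I :=
  ⟨(M.meanErasedEdges x t i j / M.meanEdges x t i j).toReal, ENNReal.toReal_nonneg, by
    refine ENNReal.toReal_le_of_le_ofReal zero_le_one ?_
    rw [ENNReal.ofReal_one]
    exact ENNReal.div_le_of_le_mul (by rw [one_mul]; exact M.meanErasedEdges_le x t i j)⟩

/-! ### Density evolution -/

/-- `y ℓ t i j`: erasure probability of the message from the class `i` type `t` check node to a
class `j` type `t` variable node in iteration `ℓ`.  In iteration `0` the check nodes have not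
received any information, so that all their incoming messages are erased. -/
def y : ℕ → Fin 2 → ℕ → ℕ → I
  | 0 => M.checkUpdate fun _ _ _ => 1
  | ℓ + 1 => M.checkUpdate (M.varUpdate (y ℓ))

/-- `x ℓ t k i`: erasure probability of the message from a class `k` type `t` variable node to the
class `i` type `t` check node in iteration `ℓ`. -/
def x (ℓ : ℕ) : Fin 2 → ℕ → ℕ → I := M.varUpdate (M.y ℓ)

/-- The average erasure probability of a message from the earlier classes to the class `i` type `t`
check node. -/
def xAvg (ℓ : ℕ) (t : Fin 2) (i : ℕ) : ℝ :=
  if i = 1 then 0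
  else if i < M.N then 1 / ((i : ℝ) - 1) * ∑ k ∈ M.earlierClasses i, (M.x ℓ t k i : ℝ)
  else 1 / ((M.N : ℝ) - 1) * ∑ k ∈ M.earlierClasses i, (M.x ℓ t k i : ℝ)

/-- `δ_i = min(i - 1, N - 1) g`. -/
def δ (t : Fin 2) (i : ℕ) : ℝ := min ((i : ℝ) - 1) ((M.N : ℝ) - 1) * M.g t

def f₁ (ℓ i : ℕ) (t : Fin 2) : ℝ := Real.exp (-(M.g t * M.x ℓ t i i))

def f₂ (ℓ i : ℕ) (t : Fin 2) : ℝ :=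
  Real.exp (-(M.δ t i * (M.meanDegree t - 1) / ((M.N : ℝ) - 1) * M.xAvg ℓ t i))

def f₃ (ℓ i : ℕ) (t : Fin 2) : ℝ :=
  M.x ℓ t i i * M.g t * Real.exp (-(M.g t * M.x ℓ t i i))

def f₄ (ℓ i : ℕ) (t : Fin 2) : ℝ :=
  M.xAvg ℓ t i * (M.δ t i * (M.meanDegree t - 1) / ((M.N : ℝ) - 1)) *
    Real.exp (-(M.δ t i * (M.meanDegree t - 1) / ((M.N : ℝ) - 1) * M.xAvg ℓ t i))

/-- The probability that at most one edge of the class `i` type `t` check node carries an erased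
message from the variable nodes in iteration `ℓ`. -/
def probAtMostOneErased (ℓ i : ℕ) (t : Fin 2) : ℝ :=
  ((M.checkEdges (M.x ℓ) t i).toOuterMeasure {a | erasedCount a ≤ 1}).toReal

end Model

end IRSA

end

/-!
The edges of a check node form a Poisson process. The proof works with one consequence of this, the
Mecke formula (`IsMecke`): if an edge `e` of a check node is tagged, then the other edges of that
node have the same joint law as the full set of edges, whatever the class of `e` and the state of
its incoming message. In formulas, `E[∑_{e ∈ a} F(e, a - e)] = E_b E_a[∑_{e ∈ a} F(e, b)]` with `b`
an independent copy of `a`. The formula is proved for a Poisson number of users contributing at most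
one edge each (`isMecke_poissonSuperpose`), from `m ℙ(m) = g ℙ(m - 1)`, and it is inherited by
independent superpositions (`isMecke_superpose`).

Two consequences give the theorem.

* The number `c` of erased messages at a check node is Poisson distributed (`IsMecke.mean_countP`):
  tagging an erased message shows that `(n + 1) ℙ(c = n + 1) = Λ ℙ(c = n)`, where the mean `Λ` is
  obtained from the access protocol in `intensity_checkEdges`. A class `i` user transmits in slot `i`
  surely and a user of an earlier class with probability `(𝓛'(1) - 1) / (N - 1)`, so that
  `Λ = g x_ii + κ x̃`, whence `ℙ(c = 0) = f₁ f₂` and `ℙ(c ≤ 1) = f₁ f₂ + f₃ f₂ + f₁ f₄`.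
* The mean number of edges to class `j` with an erased outgoing message is the mean number of edges
  to class `j` times the probability that independent copies of the two check nodes violate "no
  erased message of type `t`, at most one of the other type" (`meanErasedEdges_eq`). The first factor
  cancels in the check node update, provided that it does not vanish, and this explains why the
  result does not depend on `j`.
-/

open scoped NNReal ENNReal unitInterval

noncomputable section

namespace IRSA

/-! ### Expectations under probability mass functions -/

/-- The expectation of an `ℝ≥0∞`-valued function under a probability mass function. -/
def mean {α : Type*} (p : PMF α) (f : α → ℝ≥0∞) : ℝ≥0∞ := ∑' a, p a * f a

section Mean

variable {α β : Type*}

theorem mean_congr {p : PMF α} {f g : α → ℝ≥0∞} (h : ∀ a, p a ≠ 0 → f a = g a) :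
    mean p f = mean p g := by
  refine tsum_congr fun a => ?_
  by_cases ha : p a = 0
  · simp [ha]
  · rw [h a ha]

theorem mean_add (p : PMF α) (f g : α → ℝ≥0∞) :
    mean p (fun a => f a + g a) = mean p f + mean p g := by
  simp only [mean, mul_add]
  exact ENNReal.tsum_add

theorem mean_const_mul (p : PMF α) (c : ℝ≥0∞) (f : α → ℝ≥0∞) :
    mean p (fun a => c * f a) = c * mean p f := by
  simp only [mean, mul_left_comm _ c]
  exact ENNReal.tsum_mul_left

theorem mean_mul_const (p : PMF α) (c : ℝ≥0∞) (f : α → ℝ≥0∞) :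
    mean p (fun a => f a * c) = mean p f * c := by
  simp only [mul_comm _ c, mean_const_mul]

@[simp]
theorem mean_const (p : PMF α) (c : ℝ≥0∞) : mean p (fun _ => c) = c := by
  rw [mean, ENNReal.tsum_mul_right, p.tsum_coe, one_mul]

theorem mean_comm (p : PMF α) (q : PMF β) (f : α → β → ℝ≥0∞) :
    mean p (fun a => mean q (f a)) = mean q fun b => mean p fun a => f a b := by
  simp only [mean, ← ENNReal.tsum_mul_left]
  rw [ENNReal.tsum_comm]
  simp only [mul_left_comm]

@[simp]
theorem mean_pure (a : α) (f : α → ℝ≥0∞) : mean (PMF.pure a) f = f a := by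
  rw [mean, tsum_eq_single a]
  · simp
  · intro b hb
    rw [PMF.pure_apply_of_ne _ _ hb, zero_mul]

theorem mean_bind (p : PMF α) (q : α → PMF β) (f : β → ℝ≥0∞) :
    mean (p.bind q) f = mean p fun a => mean (q a) f := by
  simp only [mean, PMF.bind_apply, ← ENNReal.tsum_mul_right, ← ENNReal.tsum_mul_left, mul_assoc]
  exact ENNReal.tsum_comm

theorem mean_map (p : PMF α) (h : α → β) (f : β → ℝ≥0∞) :
    mean (p.map h) f = mean p fun a => f (h a) := by
  rw [PMF.map, mean_bind]
  simp

theorem mean_ite_one (p : PMF α) (s : Set α) [DecidablePred (· ∈ s)] :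
    mean p (fun a => if a ∈ s then 1 else 0) = p.toOuterMeasure s := by
  rw [mean, PMF.toOuterMeasure_apply]
  refine tsum_congr fun a => ?_
  by_cases h : a ∈ s <;> simp [h]

/-- The identity `m ℙ(m) = r ℙ(m - 1)` of the Poisson distribution.  The truncated value of `m - 1` at
`m = 0` is harmless because of the factor `m`. -/
theorem mean_toPMF_poisson_mul_pred (r : ℝ≥0) (h : ℕ → ℝ≥0∞) :
    mean (ProbabilityTheory.poissonMeasure r).toPMF (fun m => m * h (m - 1)) =
      r * mean (ProbabilityTheory.poissonMeasure r).toPMF h := by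
  rw [mean, tsum_eq_zero_add' ENNReal.summable, mean, ← ENNReal.tsum_mul_left]
  simp only [Nat.cast_zero, zero_mul, mul_zero, zero_add, Nat.add_sub_cancel, ← mul_assoc]
  refine tsum_congr fun m => ?_
  congr 1
  simp only [MeasureTheory.Measure.toPMF_apply, ProbabilityTheory.poissonMeasure_singleton]
  rw [← ENNReal.ofReal_natCast, ← ENNReal.ofReal_mul (by positivity), ← ENNReal.ofReal_coe_nnreal,
    ← ENNReal.ofReal_mul (by positivity)]
  congr 1
  rw [Nat.factorial_succ, pow_succ']
  push_cast
  field_simp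

theorem mean_toPMF_bernoulli (p : I) (f : Bool → ℝ≥0∞) :
    mean (ProbabilityTheory.bernoulliMeasure true false p).toPMF f =
      ENNReal.ofReal p * f true + ENNReal.ofReal (1 - p) * f false := by
  rw [mean, tsum_bool, add_comm]
  simp only [MeasureTheory.Measure.toPMF_apply]
  rw [ProbabilityTheory.bernoulliMeasure_apply_of_mem_of_notMem _ (by measurability) (by simp)
    (by simp), ProbabilityTheory.bernoulliMeasure_apply_of_notMem_of_mem _ (by measurability)
    (by simp) (by simp)]
  congr 2
  · rw [ENNReal.ofReal, Real.toNNReal_of_nonneg p.2.1]; rfl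
  · rw [ENNReal.ofReal, Real.toNNReal_of_nonneg (sub_nonneg.2 p.2.2)]; rfl

end Mean

/-! ### Random multisets satisfying the Mecke formula -/

section Mecke

variable {α : Type}

theorem mean_superpose_cons (p : PMF (Multiset α)) (ps : List (PMF (Multiset α)))
    (f : Multiset α → ℝ≥0∞) :
    mean (superpose (p :: ps)) f = mean p fun a => mean (superpose ps) fun b => f (a + b) := by
  rw [superpose, mean_bind]
  simp only [mean_map]

/-- The expected sum of `F` over the elements of a random multiset, that is, the integral of `F`
against the intensity measure of the multiset. -/
def intensity (p : PMF (Multiset α)) (F : α → ℝ≥0∞) : ℝ≥0∞ := mean p fun a => (a.map F).sum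

theorem intensity_const_mul (p : PMF (Multiset α)) (c : ℝ≥0∞) (F : α → ℝ≥0∞) :
    intensity p (fun e => c * F e) = c * intensity p F := by
  simp only [intensity, Multiset.sum_map_mul_left, mean_const_mul]

theorem intensity_mul_const (p : PMF (Multiset α)) (c : ℝ≥0∞) (F : α → ℝ≥0∞) :
    intensity p (fun e => F e * c) = intensity p F * c := by
  simp only [mul_comm _ c, intensity_const_mul]

theorem intensity_superpose (ps : List (PMF (Multiset α))) (F : α → ℝ≥0∞) :
    intensity (superpose ps) F = (ps.map fun p => intensity p F).sum := by
  induction ps with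
  | nil => simp [intensity, superpose]
  | cons p ps ih =>
    rw [intensity, mean_superpose_cons, List.map_cons, List.sum_cons, ← ih]
    simp only [Multiset.map_add, Multiset.sum_add, mean_add, mean_const]
    rfl

variable [DecidableEq α]

/-- The sum over the elements `e` of a multiset of a function of `e` and of the other elements. -/
def extrinsicSum (F : α → Multiset α → ℝ≥0∞) (a : Multiset α) : ℝ≥0∞ :=
  (a.map fun e => F e (a.erase e)).sum

theorem extrinsicSum_add (F : α → Multiset α → ℝ≥0∞) (a b : Multiset α) :
    extrinsicSum F (a + b) =
      extrinsicSum (fun e c => F e (c + b)) a + extrinsicSum (fun e c => F e (a + c)) b := by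
  simp only [extrinsicSum, Multiset.map_add, Multiset.sum_add]
  congr 2
  · exact Multiset.map_congr rfl fun e he => by rw [Multiset.erase_add_left_pos _ he]
  · exact Multiset.map_congr rfl fun e he => by rw [Multiset.erase_add_right_pos _ he]

/-- The Mecke formula, which characterizes Poisson processes: singling out an element of the random
multiset and looking at the others has the same effect as looking at an independent copy. -/
def IsMecke (p : PMF (Multiset α)) : Prop :=
  ∀ F : α → Multiset α → ℝ≥0∞,
    mean p (extrinsicSum F) = mean p fun b => intensity p fun e => F e b

theorem isMecke_superpose {ps : List (PMF (Multiset α))} (h : ∀ p ∈ ps, IsMecke p) :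
    IsMecke (superpose ps) := by
  induction ps with
  | nil => intro F; simp [superpose, intensity, extrinsicSum]
  | cons p ps ih =>
    intro F
    have hp := h p (by simp)
    have hps := ih fun q hq => h q (by simp [hq])
    simp only [mean_superpose_cons, extrinsicSum_add, mean_add, intensity_superpose,
      List.map_cons, List.sum_cons]
    congr 1
    · rw [mean_comm, mean_comm p]
      refine congrArg _ (funext fun b => ?_)
      exact hp fun e c => F e (c + b)
    · refine congrArg _ (funext fun a => ?_)
      simp only [← intensity_superpose]
      exact hps fun e c => F e (a + c)

theorem mean_extrinsicSum_of_card_le_one {u : PMF (Multiset α)}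
    (hu : ∀ a, u a ≠ 0 → Multiset.card a ≤ 1) (F : α → Multiset α → ℝ≥0∞) :
    mean u (extrinsicSum F) = intensity u fun e => F e 0 := by
  refine mean_congr fun a ha => congrArg _ (Multiset.map_congr rfl fun e he => ?_)
  have h := Multiset.card_erase_of_mem he
  have h0 : a.erase e = 0 := by
    rw [← Multiset.card_eq_zero]
    have := hu a ha
    rw [Nat.pred_eq_sub_one] at h
    omega
  rw [h0]

/-- If each of `m` independent copies of `u` contributes at most one point, then the point singled
out may come from any of the `m` copies, and the other points are those of the remaining copies. -/
theorem mean_extrinsicSum_superpose_replicate {u : PMF (Multiset α)}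
    (hu : ∀ a, u a ≠ 0 → Multiset.card a ≤ 1) (m : ℕ) (F : α → Multiset α → ℝ≥0∞) :
    mean (superpose (List.replicate m u)) (extrinsicSum F) =
      m * mean (superpose (List.replicate (m - 1) u)) fun b => intensity u fun e => F e b := by
  induction m generalizing F with
  | zero => simp [superpose, extrinsicSum]
  | succ m ih =>
    rw [List.replicate_succ, mean_superpose_cons]
    simp only [extrinsicSum_add, mean_add]
    have h1 : mean u (fun a => mean (superpose (List.replicate m u)) fun b =>
          extrinsicSum (fun e c => F e (c + b)) a) =
        mean (superpose (List.replicate m u)) fun b => intensity u fun e => F e b := by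
      rw [mean_comm]
      refine congrArg _ (funext fun b => ?_)
      simpa using mean_extrinsicSum_of_card_le_one hu fun e c => F e (c + b)
    rw [h1]
    simp only [ih, mean_const_mul, Nat.add_sub_cancel, Nat.cast_succ]
    rcases m with _ | m
    · simp
    · rw [Nat.add_sub_cancel, add_mul, one_mul, add_comm]
      congr 2
      rw [List.replicate_succ, mean_superpose_cons]

/-- The superposition of a Poisson number of independent copies of a random multiset. -/
def poissonSuperpose (r : ℝ≥0) (u : PMF (Multiset α)) : PMF (Multiset α) :=
  (ProbabilityTheory.poissonMeasure r).toPMF.bind fun m => superpose (List.replicate m u)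

theorem mean_extrinsicSum_poissonSuperpose (r : ℝ≥0) {u : PMF (Multiset α)}
    (hu : ∀ a, u a ≠ 0 → Multiset.card a ≤ 1) (F : α → Multiset α → ℝ≥0∞) :
    mean (poissonSuperpose r u) (extrinsicSum F) =
      r * mean (poissonSuperpose r u) fun b => intensity u fun e => F e b := by
  simp only [poissonSuperpose, mean_bind, mean_extrinsicSum_superpose_replicate hu]
  exact mean_toPMF_poisson_mul_pred r fun m =>
    mean (superpose (List.replicate m u)) fun b => intensity u fun e => F e b

theorem intensity_poissonSuperpose (r : ℝ≥0) {u : PMF (Multiset α)}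
    (hu : ∀ a, u a ≠ 0 → Multiset.card a ≤ 1) (F : α → ℝ≥0∞) :
    intensity (poissonSuperpose r u) F = r * intensity u F := by
  have h := mean_extrinsicSum_poissonSuperpose r hu fun e _ => F e
  rwa [mean_const] at h

theorem isMecke_poissonSuperpose (r : ℝ≥0) {u : PMF (Multiset α)}
    (hu : ∀ a, u a ≠ 0 → Multiset.card a ≤ 1) : IsMecke (poissonSuperpose r u) := fun F => by
  simp only [mean_extrinsicSum_poissonSuperpose r hu, intensity_poissonSuperpose r hu,
    mean_const_mul]

theorem cast_countP_eq_sum {β : Type*} (q : β → Prop) [DecidablePred q] (a : Multiset β) :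
    (a.countP q : ℝ≥0∞) = (a.map fun e => if q e then 1 else 0).sum := by
  induction a using Multiset.induction_on with
  | empty => simp
  | cons e a ih => by_cases h : q e <;> simp [h, ih, add_comm]

variable {p : PMF (Multiset α)}

/-- The recursion that determines the law of the number of elements with the property `q`: the Mecke
formula applied to a tagged element with the property and `n` further such elements. -/
theorem IsMecke.mean_countP_succ (hp : IsMecke p) (q : α → Prop) [DecidablePred q]
    (n : ℕ) :
    ((n : ℝ≥0∞) + 1) * mean p (fun a => if a.countP q = n + 1 then 1 else 0) =
      intensity p (fun e => if q e then 1 else 0) *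
        mean p (fun a => if a.countP q = n then 1 else 0) := by
  have h := hp fun e b => (if q e then 1 else 0) * (if b.countP q = n then 1 else 0)
  simp only [intensity_mul_const, mean_const_mul] at h
  rw [← h, ← mean_const_mul]
  refine congrArg _ (funext fun a => ?_)
  have hmap : a.map (fun e => (if q e then (1 : ℝ≥0∞) else 0) *
        (if (a.erase e).countP q = n then 1 else 0)) =
      a.map (fun e => (if q e then 1 else 0) * (if a.countP q = n + 1 then 1 else 0)) := by
    refine Multiset.map_congr rfl fun e he => ?_
    by_cases hq : q e
    · have : a.countP q = (a.erase e).countP q + 1 := by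
        conv_lhs => rw [← Multiset.cons_erase he]
        rw [Multiset.countP_cons_of_pos _ hq]
      simp [this]
    · simp [hq]
  rw [extrinsicSum, hmap, Multiset.sum_map_mul_right, ← cast_countP_eq_sum]
  split_ifs with h1
  · rw [h1]; push_cast; rfl
  · simp

/-- The number of elements with a given property is Poisson distributed, with mean given by the
intensity: the recursion fixes the law up to the probability of `0`, which normalization gives. -/
theorem IsMecke.mean_countP (hp : IsMecke p) (q : α → Prop) [DecidablePred q]
    {r : ℝ} (hr : 0 ≤ r)
    (hI : intensity p (fun e => if q e then 1 else 0) = ENNReal.ofReal r) (n : ℕ) :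
    mean p (fun a => if a.countP q = n then 1 else 0) =
      ENNReal.ofReal (Real.exp (-r) * r ^ n / n.factorial) := by
  have hrec : ∀ n : ℕ, mean p (fun a => if a.countP q = n then 1 else 0) =
      ENNReal.ofReal (r ^ n / n.factorial) *
        mean p (fun a => if a.countP q = 0 then 1 else 0) := by
    intro n
    induction n with
    | zero => simp
    | succ n ih =>
      have h := hp.mean_countP_succ q n
      rw [ih, hI, ← mul_assoc, ← ENNReal.ofReal_mul hr] at h
      have hn : ((n : ℝ≥0∞) + 1) ≠ 0 := by simp
      have hn' : ((n : ℝ≥0∞) + 1) ≠ ∞ := by simp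
      refine (ENNReal.mul_right_inj hn hn').1 (h.trans ?_)
      rw [← mul_assoc]
      congr 1
      rw [← Nat.cast_succ, ← ENNReal.ofReal_natCast, ← ENNReal.ofReal_mul (by positivity)]
      congr 1
      rw [Nat.factorial_succ, pow_succ']
      push_cast
      field_simp
  have hsum : ∑' n : ℕ, mean p (fun a => if a.countP q = n then 1 else 0) = 1 := by
    simp only [mean]
    rw [ENNReal.tsum_comm, ← p.tsum_coe]
    refine tsum_congr fun a => ?_
    rw [ENNReal.tsum_mul_left, tsum_eq_single (a.countP q)]
    · simp
    · intro b hb; rw [if_neg hb.symm]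
  have hexp : ∑' n : ℕ, ENNReal.ofReal (r ^ n / n.factorial) = ENNReal.ofReal (Real.exp r) := by
    have hs := NormedSpace.expSeries_div_hasSum_exp (𝔸 := ℝ) r
    rw [← Real.exp_eq_exp_ℝ] at hs
    rw [← ENNReal.ofReal_tsum_of_nonneg (fun n => by positivity) hs.summable, hs.tsum_eq]
  rw [tsum_congr hrec, ENNReal.tsum_mul_right, hexp] at hsum
  have h0 : mean p (fun a => if a.countP q = 0 then 1 else 0) = ENNReal.ofReal (Real.exp (-r)) := by
    rw [Real.exp_neg, ENNReal.ofReal_inv_of_pos (Real.exp_pos r)]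
    exact ENNReal.eq_inv_of_mul_eq_one_left (by rw [mul_comm]; exact hsum)
  rw [hrec, h0, ← ENNReal.ofReal_mul (by positivity)]
  congr 1
  ring

end Mecke

/-! ### The slots used by a user -/

/-- The tower property, where `h a` is the conditional expectation given `a`. -/
theorem mean_bindOnSupport {α β : Type*} (p : PMF α) (q : ∀ a ∈ p.support, PMF β) (f : β → ℝ≥0∞)
    {h : α → ℝ≥0∞} (hq : ∀ a ha, mean (q a ha) f = h a) :
    mean (p.bindOnSupport q) f = mean p h := by
  simp only [mean, PMF.bindOnSupport_apply, ← ENNReal.tsum_mul_right]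
  rw [ENNReal.tsum_comm]
  refine tsum_congr fun a => ?_
  simp only [mul_assoc]
  rw [ENNReal.tsum_mul_left]
  by_cases ha : p a = 0
  · simp [ha]
  · simp only [ha, dite_false]
    congr 1
    exact hq a _

theorem card_filter_mem_powersetCard {S : Finset ℕ} {i : ℕ} (hi : i ∈ S) (n : ℕ) :
    ((S.powersetCard n).filter (i ∈ ·)).card * S.card = n * (S.powersetCard n).card := by
  rcases n with _ | n
  · rw [Finset.powersetCard_zero]; simp
  have hT : i ∉ S.erase i := Finset.notMem_erase i S
  have hfilter : (S.powersetCard (n + 1)).filter (i ∈ ·) =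
      ((S.erase i).powersetCard n).image (insert i) := by
    conv_lhs => rw [← Finset.insert_erase hi, Finset.powersetCard_succ_insert hT]
    ext A
    simp only [Finset.mem_filter, Finset.mem_union, Finset.mem_image]
    constructor
    · rintro ⟨h | h, hA⟩
      · exact absurd ((Finset.mem_powersetCard.1 h).1 hA) hT
      · exact h
    · rintro ⟨B, hB, rfl⟩
      exact ⟨Or.inr ⟨B, hB, rfl⟩, Finset.mem_insert_self i B⟩
  rw [hfilter, Finset.card_image_of_injOn, Finset.card_powersetCard, Finset.card_powersetCard,
    ← Finset.card_erase_add_one hi, mul_comm, Nat.add_one_mul_choose_eq, mul_comm]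
  intro A hA B hB hAB
  have hA' : i ∉ A := fun h => hT ((Finset.mem_powersetCard.1 hA).1 h)
  have hB' : i ∉ B := fun h => hT ((Finset.mem_powersetCard.1 hB).1 h)
  rw [← Finset.erase_insert hA', ← Finset.erase_insert hB']
  exact congrArg (fun C => C.erase i) hAB

/-- A given element of `S` lies in a uniformly random `n`-subset of `S` with probability
`n / |S|`. -/
theorem mean_uniform_powersetCard_mem {S : Finset ℕ} {i : ℕ} (hi : i ∈ S) {n : ℕ}
    (h : (S.powersetCard n).Nonempty) :
    mean (PMF.uniformOfFinset (S.powersetCard n) h) (fun A => if i ∈ A then 1 else 0) =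
      ENNReal.ofReal ((n : ℝ) / S.card) := by
  rw [mean, tsum_eq_sum (s := S.powersetCard n) fun A hA => by
    rw [PMF.uniformOfFinset_apply_of_notMem _ hA, zero_mul]]
  have h1 : ∀ A ∈ S.powersetCard n, PMF.uniformOfFinset (S.powersetCard n) h A *
      (if i ∈ A then 1 else 0) = ((S.powersetCard n).card : ℝ≥0∞)⁻¹ * (if i ∈ A then 1 else 0) :=
    fun A hA => by rw [PMF.uniformOfFinset_apply_of_mem _ hA]
  have hc : (0 : ℝ) < (S.powersetCard n).card := Nat.cast_pos.2 h.card_pos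
  have hS : (0 : ℝ) < S.card := Nat.cast_pos.2 (Finset.card_pos.2 ⟨i, hi⟩)
  rw [Finset.sum_congr rfl h1, ← Finset.mul_sum, Finset.sum_boole, ← ENNReal.ofReal_natCast,
    ← ENNReal.ofReal_natCast, ← ENNReal.ofReal_inv_of_pos hc,
    ← ENNReal.ofReal_mul (by positivity)]
  congr 1
  have := card_filter_mem_powersetCard hi n
  field_simp
  rw [mul_comm _ (n : ℝ)]
  exact_mod_cast this

namespace Model

variable (M : Model)

theorem one_le_N : 1 ≤ M.N := by
  obtain ⟨d, hd⟩ := (M.L 0).support_nonempty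
  have := M.L_supp 0 d hd
  omega

theorem meanDegree_eq (t : Fin 2) :
    M.meanDegree t = ∑ d ∈ Finset.Icc 1 M.N, (M.L t d).toReal * d := by
  simp [meanDegree, degPoly, Polynomial.eval_finsetSum, Polynomial.derivative_monomial]

theorem L_eq_zero (t : Fin 2) {d : ℕ} (hd : d ∉ Finset.Icc 1 M.N) : M.L t d = 0 := by
  rw [PMF.apply_eq_zero_iff]
  exact fun h => hd (Finset.mem_Icc.2 (M.L_supp t d h))

theorem sum_L (t : Fin 2) : ∑ d ∈ Finset.Icc 1 M.N, (M.L t d).toReal = 1 := by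
  rw [← ENNReal.toReal_sum fun d _ => (M.L t).apply_ne_top d,
    ← tsum_eq_sum (L := .unconditional ℕ) (f := M.L t) fun d hd => M.L_eq_zero t hd, PMF.tsum_coe,
    ENNReal.toReal_one]

theorem one_le_meanDegree (t : Fin 2) : 1 ≤ M.meanDegree t := by
  rw [meanDegree_eq, ← M.sum_L t]
  refine Finset.sum_le_sum fun d hd => le_mul_of_one_le_right ENNReal.toReal_nonneg ?_
  exact_mod_cast (Finset.mem_Icc.1 hd).1

/-- The probability that a type `t` user transmits in a given later slot of its frame
(the junk value `0` if `N = 1`, when there is no later slot). -/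
def laterProb (t : Fin 2) : ℝ := (M.meanDegree t - 1) / ((M.N : ℝ) - 1)

theorem laterProb_nonneg (t : Fin 2) : 0 ≤ M.laterProb t :=
  div_nonneg (sub_nonneg.2 (M.one_le_meanDegree t))
    (sub_nonneg.2 (by exact_mod_cast M.one_le_N))

theorem mean_L_later (t : Fin 2) :
    mean (M.L t) (fun d => ENNReal.ofReal (((d - 1 : ℕ) : ℝ) / ((M.N - 1 : ℕ) : ℝ))) =
      ENNReal.ofReal (M.laterProb t) := by
  rw [mean, tsum_eq_sum fun d hd => by rw [M.L_eq_zero t hd, zero_mul]]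
  have h1 : ∀ d ∈ Finset.Icc 1 M.N,
      M.L t d * ENNReal.ofReal (((d - 1 : ℕ) : ℝ) / ((M.N - 1 : ℕ) : ℝ)) =
        ENNReal.ofReal ((M.L t d).toReal * (((d - 1 : ℕ) : ℝ) / ((M.N - 1 : ℕ) : ℝ))) :=
    fun d _ => by
      rw [ENNReal.ofReal_mul ENNReal.toReal_nonneg, ENNReal.ofReal_toReal ((M.L t).apply_ne_top d)]
  rw [Finset.sum_congr rfl h1, ← ENNReal.ofReal_sum_of_nonneg fun d _ => by positivity]
  congr 1
  have hsub : M.meanDegree t - 1 = ∑ d ∈ Finset.Icc 1 M.N, (M.L t d).toReal * ((d : ℝ) - 1) := by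
    simp only [mul_sub, mul_one, Finset.sum_sub_distrib, M.sum_L t, meanDegree_eq]
  rw [laterProb, hsub, Finset.sum_div]
  refine Finset.sum_congr rfl fun d hd => ?_
  rw [Nat.cast_sub (Finset.mem_Icc.1 hd).1, Nat.cast_sub M.one_le_N, Nat.cast_one]
  ring

theorem mean_userPattern_self (t : Fin 2) (k : ℕ) :
    mean (M.userPattern t k) (fun A => if k ∈ A then 1 else 0) = 1 := by
  rw [userPattern, mean_bindOnSupport (h := fun _ => 1), mean_const]
  intro d hd
  simp [mean_map]

theorem mean_userPattern_later (t : Fin 2) {k i : ℕ} (hi : i ∈ M.laterSlots k) :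
    mean (M.userPattern t k) (fun A => if i ∈ A then 1 else 0) =
      ENNReal.ofReal (M.laterProb t) := by
  have hik : i ≠ k := by
    rw [laterSlots, Finset.mem_Icc] at hi
    omega
  rw [userPattern, mean_bindOnSupport, M.mean_L_later t]
  intro d hd
  rw [mean_map]
  simp only [Finset.mem_insert, hik, false_or]
  rw [mean_uniform_powersetCard_mem hi, card_laterSlots]

theorem mean_userPattern_of_notMem (t : Fin 2) {k i : ℕ} (hik : i ≠ k) (hi : i ∉ M.laterSlots k) :
    mean (M.userPattern t k) (fun A => if i ∈ A then 1 else 0) = 0 := by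
  rw [userPattern, mean_bindOnSupport (h := fun _ => 0), mean_const]
  intro d hd
  rw [mean_map]
  refine (mean_congr (g := fun _ => 0) fun A hA => ?_).trans (mean_const _ 0)
  rw [← PMF.mem_support_iff, PMF.mem_support_uniformOfFinset_iff, Finset.mem_powersetCard] at hA
  rw [if_neg]
  rw [Finset.mem_insert, not_or]
  exact ⟨hik, fun h => hi (hA.1 h)⟩

/-! ### The edges of a check node -/

theorem card_le_one_of_userEdge_ne_zero (x : Fin 2 → ℕ → ℕ → I) (t : Fin 2) (i k : ℕ)
    (a : Multiset (ℕ × Bool)) (ha : M.userEdge x t i k a ≠ 0) : Multiset.card a ≤ 1 := by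
  rw [← PMF.mem_support_iff, userEdge, PMF.mem_support_bind_iff] at ha
  obtain ⟨A, -, hA⟩ := ha
  split_ifs at hA
  · rw [PMF.mem_support_map_iff] at hA
    obtain ⟨e, -, rfl⟩ := hA
    simp
  · rw [PMF.mem_support_pure_iff] at hA
    simp [hA]

/-- The expectation of `F` over the erasure state of an edge from a class `k` type `t` variable
node to slot `i`. -/
def edgeMean (x : Fin 2 → ℕ → ℕ → I) (t : Fin 2) (i : ℕ) (F : ℕ × Bool → ℝ≥0∞) (k : ℕ) : ℝ≥0∞ :=
  ENNReal.ofReal (x t k i) * F (k, true) + ENNReal.ofReal (1 - x t k i) * F (k, false)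

theorem intensity_userEdge (x : Fin 2 → ℕ → ℕ → I) (t : Fin 2) (i k : ℕ)
    (F : ℕ × Bool → ℝ≥0∞) :
    intensity (M.userEdge x t i k) F =
      mean (M.userPattern t k) (fun A => if i ∈ A then 1 else 0) * edgeMean x t i F k := by
  rw [intensity, userEdge, mean_bind, ← mean_mul_const]
  refine congrArg _ (funext fun A => ?_)
  split_ifs
  · simp [mean_map, mean_toPMF_bernoulli, edgeMean]
  · simp

theorem isMecke_checkEdges (x : Fin 2 → ℕ → ℕ → I) (t : Fin 2) (i : ℕ) :
    IsMecke (M.checkEdges x t i) := by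
  refine isMecke_superpose fun p hp => ?_
  obtain ⟨k, -, rfl⟩ := List.mem_map.1 hp
  exact isMecke_poissonSuperpose _ (M.card_le_one_of_userEdge_ne_zero x t i k)

theorem mem_earlierClasses {k i : ℕ} :
    k ∈ M.earlierClasses i ↔ 1 ≤ k ∧ i ∈ M.laterSlots k := by
  have := M.one_le_N
  rw [earlierClasses, laterSlots, Finset.mem_Icc]
  split_ifs <;> rw [Finset.mem_Icc] <;> omega

theorem sum_map_range' (h : ℕ → ℝ≥0∞) (i : ℕ) :
    ((List.range' 1 i).map h).sum = ∑ k ∈ Finset.Icc 1 i, h k := by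
  induction i with
  | zero => simp
  | succ i ih =>
    rw [List.range'_1_concat, List.map_append, List.sum_append, ih,
      Finset.sum_Icc_succ_top (by omega)]
    simp [add_comm]

/-- The intensity of the edges of a check node: class `i` users are present with rate `g`, and users
of each earlier class with the rate thinned by the probability of hitting slot `i`. -/
theorem intensity_checkEdges (x : Fin 2 → ℕ → ℕ → I) (t : Fin 2) {i : ℕ} (hi : 1 ≤ i)
    (F : ℕ × Bool → ℝ≥0∞) :
    intensity (M.checkEdges x t i) F =
      M.g t * edgeMean x t i F i +
        ∑ k ∈ M.earlierClasses i, M.g t * ENNReal.ofReal (M.laterProb t) * edgeMean x t i F k := by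
  have hclass : ∀ k, intensity (M.classEdges x t i k) F =
      M.g t * (mean (M.userPattern t k) (fun A => if i ∈ A then 1 else 0) *
        edgeMean x t i F k) := fun k => by
    rw [← intensity_userEdge]
    exact intensity_poissonSuperpose _ (M.card_le_one_of_userEdge_ne_zero x t i k) F
  have hnot : i ∉ M.earlierClasses i := by
    rw [mem_earlierClasses, laterSlots, Finset.mem_Icc]; omega
  have hsub : insert i (M.earlierClasses i) ⊆ Finset.Icc 1 i := by
    intro k hk
    rw [Finset.mem_insert, mem_earlierClasses, laterSlots, Finset.mem_Icc] at hk
    rw [Finset.mem_Icc]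
    omega
  rw [checkEdges, intensity_superpose, List.map_map, Function.comp_def, sum_map_range',
    ← Finset.sum_subset hsub, Finset.sum_insert hnot]
  · congr 1
    · rw [hclass, mean_userPattern_self, one_mul]
    · refine Finset.sum_congr rfl fun k hk => ?_
      rw [hclass, M.mean_userPattern_later t (M.mem_earlierClasses.1 hk).2, mul_assoc]
  · intro k hk hk'
    rw [Finset.mem_insert, not_or, mem_earlierClasses] at hk'
    have hik : i ≠ k := fun h => hk'.1 h.symm
    rw [hclass, M.mean_userPattern_of_notMem t hik fun h =>
      hk'.2 ⟨(Finset.mem_Icc.1 hk).1, h⟩, zero_mul, mul_zero]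

theorem edgeMean_const (x : Fin 2 → ℕ → ℕ → I) (t : Fin 2) (i k : ℕ) (h : ℕ → ℝ≥0∞) :
    edgeMean x t i (fun e => h e.1) k = h k := by
  rw [edgeMean, ← add_mul, ← ENNReal.ofReal_add (x t k i).2.1 (sub_nonneg.2 (x t k i).2.2)]
  simp

theorem intensity_checkEdges_self (x : Fin 2 → ℕ → ℕ → I) (t : Fin 2) {i : ℕ} (hi : 1 ≤ i) :
    intensity (M.checkEdges x t i) (fun e => if e.1 = i then 1 else 0) = M.g t := by
  have hnot : i ∉ M.earlierClasses i := by
    rw [mem_earlierClasses, laterSlots, Finset.mem_Icc]; omega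
  rw [M.intensity_checkEdges x t hi]
  simp only [edgeMean_const x t i _ fun k => if k = i then 1 else 0]
  simp [hnot]

theorem intensity_checkEdges_earlier (x : Fin 2 → ℕ → ℕ → I) (t : Fin 2) {i j : ℕ} (hi : 1 ≤ i)
    (hj : j ∈ M.earlierClasses i) :
    intensity (M.checkEdges x t i) (fun e => if e.1 = j then 1 else 0) =
      M.g t * ENNReal.ofReal (M.laterProb t) := by
  have hij : i ≠ j := by
    rw [mem_earlierClasses, laterSlots, Finset.mem_Icc] at hj; omega
  rw [M.intensity_checkEdges x t hi]
  simp only [edgeMean_const x t i _ fun k => if k = j then 1 else 0]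
  simp [hij, hj]

/-- The expected number of erased messages that arrive at the type `t` check node of slot `i`. -/
def erasedRate (x : Fin 2 → ℕ → ℕ → I) (t : Fin 2) (i : ℕ) : ℝ :=
  M.g t * x t i i + M.g t * M.laterProb t * ∑ k ∈ M.earlierClasses i, (x t k i : ℝ)

theorem erasedRate_nonneg (x : Fin 2 → ℕ → ℕ → I) (t : Fin 2) (i : ℕ) : 0 ≤ M.erasedRate x t i :=
  add_nonneg (mul_nonneg (M.g t).coe_nonneg (x t i i).2.1)
    (mul_nonneg (mul_nonneg (M.g t).coe_nonneg (M.laterProb_nonneg t))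
      (Finset.sum_nonneg fun k _ => (x t k i).2.1))

theorem intensity_checkEdges_erased (x : Fin 2 → ℕ → ℕ → I) (t : Fin 2) {i : ℕ} (hi : 1 ≤ i) :
    intensity (M.checkEdges x t i) (fun e => if e.2 = true then 1 else 0) =
      ENNReal.ofReal (M.erasedRate x t i) := by
  have hρ := M.laterProb_nonneg t
  have hs : 0 ≤ ∑ k ∈ M.earlierClasses i, (x t k i : ℝ) :=
    Finset.sum_nonneg fun k _ => (x t k i).2.1
  rw [M.intensity_checkEdges x t hi, erasedRate, ENNReal.ofReal_add
    (mul_nonneg (M.g t).coe_nonneg (x t i i).2.1) (mul_nonneg (mul_nonneg (M.g t).coe_nonneg hρ) hs),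
    ENNReal.ofReal_mul (M.g t).coe_nonneg, ENNReal.ofReal_mul (mul_nonneg (M.g t).coe_nonneg hρ),
    ENNReal.ofReal_mul (M.g t).coe_nonneg,
    ENNReal.ofReal_sum_of_nonneg fun k _ => (x t k i).2.1, ← Finset.mul_sum]
  simp [edgeMean]

/-! ### The number of erased messages at a check node -/

/-- The number of erased messages arriving at a check node is Poisson distributed. -/
theorem mean_erasedCount_eq (x : Fin 2 → ℕ → ℕ → I) (t : Fin 2) {i : ℕ} (hi : 1 ≤ i) (n : ℕ) :
    mean (M.checkEdges x t i) (fun a => if erasedCount a = n then 1 else 0) =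
      ENNReal.ofReal (Real.exp (-M.erasedRate x t i) * M.erasedRate x t i ^ n / n.factorial) :=
  (M.isMecke_checkEdges x t i).mean_countP _ (M.erasedRate_nonneg x t i)
    (M.intensity_checkEdges_erased x t hi) n

theorem mean_erasedCount_eq_zero (x : Fin 2 → ℕ → ℕ → I) (t : Fin 2) {i : ℕ} (hi : 1 ≤ i) :
    mean (M.checkEdges x t i) (fun a => if erasedCount a = 0 then 1 else 0) =
      ENNReal.ofReal (Real.exp (-M.erasedRate x t i)) := by
  simpa using M.mean_erasedCount_eq x t hi 0

theorem mean_erasedCount_le_one (x : Fin 2 → ℕ → ℕ → I) (t : Fin 2) {i : ℕ} (hi : 1 ≤ i) :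
    mean (M.checkEdges x t i) (fun a => if erasedCount a ≤ 1 then 1 else 0) =
      ENNReal.ofReal ((1 + M.erasedRate x t i) * Real.exp (-M.erasedRate x t i)) := by
  have hr := M.erasedRate_nonneg x t i
  have hsplit : ∀ a : Multiset (ℕ × Bool), (if erasedCount a ≤ 1 then (1 : ℝ≥0∞) else 0) =
      (if erasedCount a = 0 then 1 else 0) + (if erasedCount a = 1 then 1 else 0) := fun a => by
    rcases erasedCount a with _ | _ | n <;> simp
  simp only [hsplit, mean_add, M.mean_erasedCount_eq x t hi]
  rw [← ENNReal.ofReal_add (by positivity) (by positivity)]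
  congr 1
  simp
  ring

/-! ### The erasure probability of an outgoing message -/

/-- The two check nodes of a slot are independent; `t.rev` is the type other than `t`. -/
theorem tsum_slotWeight_mul (x : Fin 2 → ℕ → ℕ → I) (t : Fin 2) (i : ℕ)
    (f : Multiset (ℕ × Bool) → Multiset (ℕ × Bool) → ℝ≥0∞) :
    ∑' ω, M.slotWeight x i ω * f (ω t) (ω t.rev) =
      mean (M.checkEdges x t i) fun a => mean (M.checkEdges x t.rev i) fun b => f a b := by
  rw [← (finTwoArrowEquiv (Multiset (ℕ × Bool))).symm.tsum_eq, ENNReal.tsum_prod']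
  fin_cases t
  · simp only [mean, ← ENNReal.tsum_mul_left]
    refine tsum_congr fun a => tsum_congr fun b => ?_
    simp [slotWeight, Fin.prod_univ_two, finTwoArrowEquiv, mul_assoc]
  · rw [ENNReal.tsum_comm]
    simp only [mean, ← ENNReal.tsum_mul_left]
    refine tsum_congr fun a => tsum_congr fun b => ?_
    simp [slotWeight, Fin.prod_univ_two, finTwoArrowEquiv]
    ring

theorem extrinsicPattern_mem_decodableSet (ω : Fin 2 → Multiset (ℕ × Bool)) (t : Fin 2)
    (e : ℕ × Bool) :
    extrinsicPattern ω t e ∈ decodableSet t ↔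
      erasedCount ((ω t).erase e) = 0 ∧ erasedCount (ω t.rev) ≤ 1 := by
  have h01 : (Finset.univ.filter fun s : Fin 2 => 0 < s) = {1} := by decide
  have h11 : (Finset.univ.filter fun s : Fin 2 => 1 < s) = ∅ := by decide
  fin_cases t
  · simp [decodableSet, extrinsicPattern, h01]
  · simp [decodableSet, extrinsicPattern, h11]

theorem meanEdges_eq (x : Fin 2 → ℕ → ℕ → I) (t : Fin 2) (i j : ℕ) :
    M.meanEdges x t i j =
      intensity (M.checkEdges x t i) (fun e => if e.1 = j then 1 else 0) := by
  rw [meanEdges]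
  refine (M.tsum_slotWeight_mul x t i fun a _ => (a.countP fun e => e.1 = j : ℕ)).trans ?_
  simp only [mean_const, cast_countP_eq_sum]
  rfl

/-- The Mecke formula for the tagged edge: the other edges of its check node are distributed like
all the edges of the check node, so that the erasure probability does not depend on the class `j`
of the edge. -/
theorem meanErasedEdges_eq (x : Fin 2 → ℕ → ℕ → I) (t : Fin 2) {i : ℕ} (hi : 1 ≤ i) (j : ℕ) :
    M.meanErasedEdges x t i j =
      M.meanEdges x t i j * ENNReal.ofReal (1 - Real.exp (-M.erasedRate x t i) *
        ((1 + M.erasedRate x t.rev i) * Real.exp (-M.erasedRate x t.rev i))) := by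
  classical
  -- `G c b` indicates that the message is erased, when `c` are the other edges of its own type
  -- and `b` are the edges of the other type.
  let G : Multiset (ℕ × Bool) → Multiset (ℕ × Bool) → ℝ≥0∞ := fun c b =>
    if erasedCount c = 0 ∧ erasedCount b ≤ 1 then 0 else 1
  let F : Multiset (ℕ × Bool) → ℕ × Bool → Multiset (ℕ × Bool) → ℝ≥0∞ := fun b e c =>
    (if e.1 = j then 1 else 0) * G c b
  have h1 : M.meanErasedEdges x t i j =
      mean (M.checkEdges x t i) fun a => mean (M.checkEdges x t.rev i) fun b =>
        extrinsicSum (F b) a := by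
    rw [meanErasedEdges, ← tsum_slotWeight_mul]
    refine tsum_congr fun ω => ?_
    rw [erasedEdgesTo, cast_countP_eq_sum, extrinsicSum]
    congr 2
    refine Multiset.map_congr rfl fun e _ => ?_
    rw [extrinsicPattern_mem_decodableSet]
    by_cases he : e.1 = j <;>
      by_cases hd : erasedCount ((ω t).erase e) = 0 ∧ erasedCount (ω t.rev) ≤ 1 <;>
      simp [F, G, he, hd]
  have hG : mean (M.checkEdges x t.rev i) (fun b => mean (M.checkEdges x t i) fun c => G c b) =
      ENNReal.ofReal (1 - Real.exp (-M.erasedRate x t i) *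
        ((1 + M.erasedRate x t.rev i) * Real.exp (-M.erasedRate x t.rev i))) := by
    -- The complementary event is a product event; adding its probability, rather than subtracting
    -- it from `1`, avoids truncated subtraction inside the expectations.
    have hadd : mean (M.checkEdges x t.rev i) (fun b => mean (M.checkEdges x t i) fun c => G c b) +
        ENNReal.ofReal (Real.exp (-M.erasedRate x t i) *
          ((1 + M.erasedRate x t.rev i) * Real.exp (-M.erasedRate x t.rev i))) = 1 := by
      rw [ENNReal.ofReal_mul (Real.exp_pos _).le, ← M.mean_erasedCount_eq_zero x t hi,
        ← M.mean_erasedCount_le_one x t.rev hi, ← mean_const_mul]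
      simp only [← mean_mul_const]
      simp only [← mean_add]
      have hone : ∀ b c, G c b + (if erasedCount c = 0 then 1 else 0) *
          (if erasedCount b ≤ 1 then 1 else 0) = 1 := fun b c => by
        by_cases hc : erasedCount c = 0 <;> by_cases hb : erasedCount b ≤ 1 <;> simp [G, hc, hb]
      simp only [hone, mean_const]
    rw [ENNReal.ofReal_sub _ (mul_nonneg (Real.exp_pos _).le (mul_nonneg
      (add_nonneg zero_le_one (M.erasedRate_nonneg x t.rev i)) (Real.exp_pos _).le)),
      ENNReal.ofReal_one]
    exact ENNReal.eq_sub_of_add_eq ENNReal.ofReal_ne_top hadd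
  rw [h1, mean_comm, meanEdges_eq, ← hG, ← mean_const_mul]
  refine congrArg _ (funext fun b => ?_)
  rw [M.isMecke_checkEdges x t i (F b)]
  simp only [F, intensity_mul_const, mean_const_mul]

theorem checkUpdate_eq (x : Fin 2 → ℕ → ℕ → I) (t : Fin 2) {i : ℕ} (hi : 1 ≤ i) (j : ℕ)
    (h0 : M.meanEdges x t i j ≠ 0) (htop : M.meanEdges x t i j ≠ ∞) :
    (M.checkUpdate x t i j : ℝ) = 1 - Real.exp (-M.erasedRate x t i) *
      ((1 + M.erasedRate x t.rev i) * Real.exp (-M.erasedRate x t.rev i)) := by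
  have hle (s : Fin 2) : (1 + M.erasedRate x s i) * Real.exp (-M.erasedRate x s i) ≤ 1 := by
    rw [Real.exp_neg, ← div_eq_mul_inv, div_le_one (Real.exp_pos _), add_comm]
    exact Real.add_one_le_exp _
  have hexp : Real.exp (-M.erasedRate x t i) ≤ 1 :=
    Real.exp_le_one_iff.2 (neg_nonpos.2 (M.erasedRate_nonneg x t i))
  change (M.meanErasedEdges x t i j / M.meanEdges x t i j).toReal = _
  rw [M.meanErasedEdges_eq x t hi, mul_comm, ENNReal.mul_div_cancel_right h0 htop,
    ENNReal.toReal_ofReal]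
  exact sub_nonneg.2 (mul_le_one₀ hexp (mul_nonneg
    (add_nonneg zero_le_one (M.erasedRate_nonneg x t.rev i)) (Real.exp_pos _).le) (hle _))

/-! ### The closed form -/

/-- With the junk value of the quotient, this also holds when `N = 1`, where both sides vanish. -/
theorem kappa_mul_xAvg (ℓ : ℕ) (t : Fin 2) (i : ℕ) :
    M.δ t i * (M.meanDegree t - 1) / ((M.N : ℝ) - 1) * M.xAvg ℓ t i =
      M.g t * M.laterProb t * ∑ k ∈ M.earlierClasses i, (M.x ℓ t k i : ℝ) := by
  have hN := M.one_le_N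
  rw [δ, laterProb, xAvg]
  split_ifs with h1 h2
  · have : M.earlierClasses i = ∅ := by
      rw [Finset.eq_empty_iff_forall_notMem]
      intro k hk
      rw [mem_earlierClasses, laterSlots, Finset.mem_Icc] at hk
      omega
    rw [this, Finset.sum_empty, mul_zero, mul_zero]
  · have hi0 : (i : ℝ) - 1 ≠ 0 := sub_ne_zero.2 (by exact_mod_cast h1)
    have hle : (i : ℝ) - 1 ≤ (M.N : ℝ) - 1 := by
      have : (i : ℝ) ≤ M.N := by exact_mod_cast h2.le
      linarith
    rw [min_eq_left hle]
    field_simp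
  · have hle : (M.N : ℝ) - 1 ≤ (i : ℝ) - 1 := by
      have : (M.N : ℝ) ≤ i := by exact_mod_cast not_lt.1 h2
      linarith
    rw [min_eq_right hle]
    by_cases hN1 : (M.N : ℝ) - 1 = 0
    · simp [hN1]
    · field_simp

theorem erasedRate_x (ℓ : ℕ) (t : Fin 2) (i : ℕ) :
    M.erasedRate (M.x ℓ) t i = M.g t * M.x ℓ t i i +
      M.δ t i * (M.meanDegree t - 1) / ((M.N : ℝ) - 1) * M.xAvg ℓ t i := by
  rw [M.kappa_mul_xAvg ℓ t i, erasedRate]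

theorem exp_neg_erasedRate (ℓ : ℕ) (t : Fin 2) (i : ℕ) :
    Real.exp (-M.erasedRate (M.x ℓ) t i) = M.f₁ ℓ i t * M.f₂ ℓ i t := by
  rw [M.erasedRate_x ℓ t i, f₁, f₂, ← Real.exp_add, neg_add]

theorem one_add_erasedRate_mul_exp (ℓ : ℕ) (t : Fin 2) (i : ℕ) :
    (1 + M.erasedRate (M.x ℓ) t i) * Real.exp (-M.erasedRate (M.x ℓ) t i) =
      M.f₁ ℓ i t * M.f₂ ℓ i t + M.f₃ ℓ i t * M.f₂ ℓ i t + M.f₁ ℓ i t * M.f₄ ℓ i t := by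
  rw [M.exp_neg_erasedRate ℓ t i, M.erasedRate_x ℓ t i]
  simp only [f₁, f₂, f₃, f₄]
  ring

theorem y_succ_eq (ℓ : ℕ) (t : Fin 2) {i : ℕ} (hi : 1 ≤ i) (j : ℕ)
    (h0 : M.meanEdges (M.x ℓ) t i j ≠ 0) (htop : M.meanEdges (M.x ℓ) t i j ≠ ∞) :
    (M.y (ℓ + 1) t i j : ℝ) = 1 - M.f₁ ℓ i t * M.f₂ ℓ i t *
      ∏ s ∈ Finset.univ.filter (fun s => s ≠ t),
        (M.f₁ ℓ i s * M.f₂ ℓ i s + M.f₃ ℓ i s * M.f₂ ℓ i s + M.f₁ ℓ i s * M.f₄ ℓ i s) := by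
  have hfilter : ∀ t : Fin 2, (Finset.univ.filter fun s : Fin 2 => s ≠ t) = {t.rev} := by decide
  rw [hfilter t, Finset.prod_singleton, ← M.exp_neg_erasedRate ℓ t i,
    ← M.one_add_erasedRate_mul_exp ℓ t.rev i]
  exact M.checkUpdate_eq (M.x ℓ) t hi j h0 htop

theorem probAtMostOneErased_eq (ℓ : ℕ) (t : Fin 2) {i : ℕ} (hi : 1 ≤ i) :
    M.probAtMostOneErased ℓ i t =
      M.f₁ ℓ i t * M.f₂ ℓ i t + M.f₃ ℓ i t * M.f₂ ℓ i t + M.f₁ ℓ i t * M.f₄ ℓ i t := by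
  rw [probAtMostOneErased, ← mean_ite_one, ← M.one_add_erasedRate_mul_exp ℓ t i]
  simp only [Set.mem_ofPred_eq]
  rw [M.mean_erasedCount_le_one (M.x ℓ) t hi, ENNReal.toReal_ofReal]
  exact mul_nonneg (add_nonneg zero_le_one (M.erasedRate_nonneg _ t i)) (Real.exp_pos _).le

end Model

end IRSA

end

theorem proposition2 (M : IRSA.Model) (ℓ i : ℕ) (hi : 1 ≤ i) (t : Fin 2) :
    (0 < M.g t →
      (M.y (ℓ + 1) t i i : ℝ) = 1 - M.f₁ ℓ i t * M.f₂ ℓ i t *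
        ∏ s ∈ Finset.univ.filter (fun s => s ≠ t),
          (M.f₁ ℓ i s * M.f₂ ℓ i s + M.f₃ ℓ i s * M.f₂ ℓ i s + M.f₁ ℓ i s * M.f₄ ℓ i s)) ∧
    (0 < M.g t → 1 < M.meanDegree t → ∀ j ∈ M.earlierClasses i,
      (M.y (ℓ + 1) t i j : ℝ) = 1 - M.f₁ ℓ i t * M.f₂ ℓ i t *
        ∏ s ∈ Finset.univ.filter (fun s => s ≠ t),
          (M.f₁ ℓ i s * M.f₂ ℓ i s + M.f₃ ℓ i s * M.f₂ ℓ i s + M.f₁ ℓ i s * M.f₄ ℓ i s)) ∧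
    M.probAtMostOneErased ℓ i t =
      M.f₁ ℓ i t * M.f₂ ℓ i t + M.f₃ ℓ i t * M.f₂ ℓ i t + M.f₁ ℓ i t * M.f₄ ℓ i t := by
  refine ⟨fun hg => ?_, fun hg hd j hj => ?_, M.probAtMostOneErased_eq ℓ t hi⟩
  · have hmean : M.meanEdges (M.x ℓ) t i i = M.g t := by
      rw [M.meanEdges_eq, M.intensity_checkEdges_self _ t hi]
    refine M.y_succ_eq ℓ t hi i ?_ ?_ <;> rw [hmean]
    · exact ENNReal.coe_ne_zero.2 hg.ne'
    · exact ENNReal.coe_ne_top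
  · have hmean : M.meanEdges (M.x ℓ) t i j = M.g t * ENNReal.ofReal (M.laterProb t) := by
      rw [M.meanEdges_eq, M.intensity_checkEdges_earlier _ t hi hj]
    -- an earlier class has a later slot, so that `N ≥ 2` and `laterProb` is not a division by zero
    have hN : 1 < M.N := by
      have hj' := (M.mem_earlierClasses.1 hj).2
      rw [IRSA.Model.laterSlots, Finset.mem_Icc] at hj'
      omega
    have hpos : 0 < M.laterProb t :=
      div_pos (sub_pos.2 hd) (sub_pos.2 (by exact_mod_cast hN))
    refine M.y_succ_eq ℓ t hi j ?_ ?_ <;> rw [hmean]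
    · exact mul_ne_zero (ENNReal.coe_ne_zero.2 hg.ne') (ENNReal.ofReal_pos.2 hpos).ne'
    · exact ENNReal.mul_ne_top ENNReal.coe_ne_top ENNReal.ofReal_ne_top
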